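/- Let $d$ be a prime, $n\ge 0$, $\omega=e^{2\pi i/d}$, $\tau=(-1)^d e^{\pi i/d}$, and let $D$ be the order of $\tau$ ($D=d$ for odd $d$, $D=4$ for $d=2$). The $n$-qudit Clifford group $\mathrm{Cl}$ is the subgroup of the unitary group of $(\mathbb{C}^d)^{\otimes n}$ generated by $\mathrm H=d^{-1/2}\sum_{x,y\in\mathbb{Z}_d}\omega^{xy}|x\rangle\langle y|$ on any qudit, the phase gate on any qudit ($\mathrm P=\sum_x\tau^{x^2}|x\rangle\langle x|$ if $d=2$, $\mathrm P=\sum_x\tau^{x(x-1)}|x\rangle\langle x|$ if $d$ is odd), and $\mathrm{CADD}=\sum_{x,y}|x,x+y\rangle\langle x,y|$ on any ordered pair of distinct qudits. For $r,s\in\mathbb{N}$ let $\Delta_{r,s}(U)=U^{\otimes r}\otimes\bar U^{\otimes s}$ be the corresponding tensor power representation of $\mathrm{Cl}$. The standard basis $|F\rangle$ of its representation space is labelled by the $(r+s)\times n$ matrices $F$ over $\mathbb{Z}_d$, the $i$-th row of $F$ labelling the basis state of the $i$-th tensor factor $(\mathbb{C}^d)^{\otimes n}$. Let $$q_{r,s}:\mathbb{Z}_d^{r+s}\to\mathbb{Z}_D,\qquad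 q_{r,s}(u)=\sum_{i\le r}u_i^2-\sum_{i>r}u_i^2 \pmod D$$ (for $d=2$, the square modulo $4$ of $u_i\in\mathbb{Z}_2$ is computed on any integer representative of $u_i$). **Lemma.** Let $r,s,r',s'\in\mathbb{N}$ with $r+s=r'+s'$ and, if $d$ is odd, $r-s\equiv r'-s'\pmod d$. Suppose that one of the following holds: 1. $d\equiv 1\pmod 4$; 2. $d\equiv 3\pmod 4$ and $s\equiv s'\pmod 2$; 3. $d=2$ and $r-s\equiv r'-s'\pmod 8$. Then $\Delta_{r,s}\simeq\Delta_{r',s'}$ as representations of $\mathrm{Cl}$. More precisely, there is an invertible linear map $g$ of $\mathbb{Z}_d^{r+s}$ with $q_{r',s'}(gu)=q_{r,s}(u)$ for all $u$, such that the basis permutation $|F\rangle\mapsto|gF\rangle$ is an isomorphism from $\Delta_{r,s}$ to $\Delta_{r',s'}$. -/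

import Mathlib

namespace CliffordTensor

/-- The tensor product `⨂ i, A i` of a finite family of square matrices.  The space
`(ℂ^κ)^{⊗ ι}` is modelled on its standard basis `|x⟩`, `x : ι → κ`, that is, as the space of
functions `(ι → κ) → ℂ`, and operators on it as matrices indexed by `ι → κ`. -/
def tensorMatrix {ι κ : Type*} [Fintype ι] (A : ι → Matrix κ κ ℂ) :
    Matrix (ι → κ) (ι → κ) ℂ :=
  Matrix.of fun x y => ∏ i, A i (x i) (y i)

theorem tensorMatrix_mul {ι κ : Type*} [Fintype ι] [DecidableEq ι] [Fintype κ]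
    (A B : ι → Matrix κ κ ℂ) :
    tensorMatrix A * tensorMatrix B = tensorMatrix fun i => A i * B i := by
  ext x y
  simp only [tensorMatrix, Matrix.mul_apply, Matrix.of_apply, Finset.prod_univ_sum,
    Fintype.piFinset_univ, Finset.prod_mul_distrib]

theorem tensorMatrix_one {ι κ : Type*} [Fintype ι] [DecidableEq κ] :
    tensorMatrix (fun _ : ι => (1 : Matrix κ κ ℂ)) = 1 := by
  ext x y
  simp only [tensorMatrix, Matrix.of_apply, Matrix.one_apply, Finset.prod_ite_zero,
    Finset.mem_univ, true_imp_iff, Finset.prod_const_one, funext_iff]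

theorem tensorMatrix_mem_unitary {ι κ : Type*} [Fintype ι] [DecidableEq ι] [Fintype κ]
    [DecidableEq κ] (A : ι → Matrix κ κ ℂ) (hA : ∀ i, A i ∈ Matrix.unitaryGroup κ ℂ) :
    tensorMatrix A ∈ Matrix.unitaryGroup (ι → κ) ℂ := by
  rw [Matrix.mem_unitaryGroup_iff']
  have h : star (tensorMatrix A) = tensorMatrix fun i => star (A i) := by
    ext x y
    simp [tensorMatrix, Matrix.star_apply]
  rw [h, tensorMatrix_mul]
  simp only [fun i => Matrix.mem_unitaryGroup_iff'.1 (hA i), tensorMatrix_one]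

/-! ### The Clifford group -/

/-- The primitive `d`-th root of unity `ω = exp(2πi/d)`. -/
noncomputable def omega (d : ℕ) : ℂ := Complex.exp (2 * Real.pi * Complex.I / d)

/-- `τ = (-1)^d exp(πi/d)`, a square root of `ω`. -/
noncomputable def tau (d : ℕ) : ℂ := (-1) ^ d * Complex.exp (Real.pi * Complex.I / d)

/-- The order `D` of `τ`: it is `2d` for even `d` and `d` for odd `d`. -/
def bigD (d : ℕ) : ℕ := if Even d then 2 * d else d

/-- The discrete Fourier transform `H = d^{-1/2} ∑_{x,y} ω^{xy} |x⟩⟨y|` on one qudit. -/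
noncomputable def fourierGate (d : ℕ) : Matrix (ZMod d) (ZMod d) ℂ :=
  Matrix.of fun x y => ((Real.sqrt d : ℝ) : ℂ)⁻¹ * omega d ^ (x.val * y.val)

/-- The phase gate `P` on one qudit: `∑_x τ^{x²} |x⟩⟨x|` for even `d`,
`∑_x τ^{x(x-1)} |x⟩⟨x|` for odd `d`. -/
noncomputable def phaseGate (d : ℕ) : Matrix (ZMod d) (ZMod d) ℂ :=
  Matrix.diagonal fun x =>
    if Even d then tau d ^ (x.val ^ 2) else tau d ^ ((x.val : ℤ) * ((x.val : ℤ) - 1))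

/-- The one-qudit gate `A` applied to qudit `i` out of `n`. -/
def onQudit {n d : ℕ} (i : Fin n) (A : Matrix (ZMod d) (ZMod d) ℂ) :
    Matrix (Fin n → ZMod d) (Fin n → ZMod d) ℂ :=
  tensorMatrix fun k => if k = i then A else 1

/-- The controlled addition `|x⟩ ↦ |x'⟩` with control `i` and target `j`:
`x'_j = x_i + x_j`, all other entries being unchanged. -/
def caddGate {n d : ℕ} (i j : Fin n) :
    Matrix (Fin n → ZMod d) (Fin n → ZMod d) ℂ :=
  Matrix.of fun x y => if x = Function.update y j (y i + y j) then 1 else 0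

theorem omega_pow_val_mul (d : ℕ) [NeZero d] (x y : ZMod d) :
    omega d ^ (x.val * y.val) = ZMod.stdAddChar (x * y) := by
  have h : (x * y : ZMod d) = (((x.val * y.val : ℕ) : ℤ) : ZMod d) := by
    push_cast
    simp
  rw [h, ZMod.stdAddChar_coe, omega, ← Complex.exp_nat_mul]
  congr 1
  push_cast
  ring

theorem fourierGate_mem_unitary (d : ℕ) [NeZero d] :
    fourierGate d ∈ Matrix.unitaryGroup (ZMod d) ℂ := by
  rw [Matrix.mem_unitaryGroup_iff']
  ext x y
  have hd : (d : ℂ) ≠ 0 := Nat.cast_ne_zero.2 (NeZero.ne d)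
  have hs : ((Real.sqrt d : ℝ) : ℂ)⁻¹ * ((Real.sqrt d : ℝ) : ℂ)⁻¹ = (d : ℂ)⁻¹ := by
    rw [← mul_inv, ← Complex.ofReal_mul, Real.mul_self_sqrt (Nat.cast_nonneg d)]
    simp
  have key : ∀ z : ZMod d, star (fourierGate d z x) * fourierGate d z y
      = (d : ℂ)⁻¹ * ZMod.stdAddChar (z * (y - x)) := by
    intro z
    simp only [fourierGate, Matrix.of_apply, omega_pow_val_mul, star_mul', star_inv₀]
    rw [← hs, mul_sub, AddChar.map_sub_eq_div, div_eq_mul_inv, ← AddChar.map_neg_eq_inv]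
    have h1 : star (((Real.sqrt d : ℝ) : ℂ)) = ((Real.sqrt d : ℝ) : ℂ) := Complex.conj_ofReal _
    have h2 : star (ZMod.stdAddChar (z * x) : ℂ) = ZMod.stdAddChar (-(z * x)) := by
      rw [AddChar.map_neg_eq_conj]
      rfl
    rw [h1, h2]
    ring
  simp only [Matrix.mul_apply, Matrix.star_apply, key]
  rw [← Finset.mul_sum, AddChar.sum_mulShift _ (ZMod.isPrimitive_stdAddChar d), ZMod.card,
    Matrix.one_apply]
  by_cases hxy : x = y
  · simp [hxy, hd]
  · simp [hxy, sub_eq_zero, Ne.symm hxy]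

theorem norm_tau (d : ℕ) : ‖tau d‖ = 1 := by
  rw [tau, norm_mul, norm_pow, norm_neg, norm_one, one_pow, one_mul, Complex.norm_exp]
  simp

theorem phaseGate_mem_unitary (d : ℕ) [NeZero d] :
    phaseGate d ∈ Matrix.unitaryGroup (ZMod d) ℂ := by
  rw [Matrix.mem_unitaryGroup_iff']
  simp only [phaseGate, Matrix.star_eq_conjTranspose, Matrix.diagonal_conjTranspose,
    Matrix.diagonal_mul_diagonal]
  rw [← Matrix.diagonal_one]
  congr 1
  funext x
  rw [Pi.star_apply]
  have h : ∀ z : ℂ, ‖z‖ = 1 → star z * z = 1 := fun z hz => by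
    have h1 := Complex.conj_mul' z
    rw [hz] at h1
    simpa using h1
  apply h
  split_ifs
  · rw [norm_pow, norm_tau, one_pow]
  · rw [norm_zpow, norm_tau, one_zpow]

theorem onQudit_mem_unitary {n d : ℕ} [NeZero d] (i : Fin n) (A : Matrix (ZMod d) (ZMod d) ℂ)
    (hA : A ∈ Matrix.unitaryGroup (ZMod d) ℂ) :
    onQudit i A ∈ Matrix.unitaryGroup (Fin n → ZMod d) ℂ := by
  refine tensorMatrix_mem_unitary _ fun k => ?_
  split_ifs
  · exact hA
  · exact one_mem _

theorem caddGate_mem_unitary {n d : ℕ} [NeZero d] {i j : Fin n} (hij : i ≠ j) :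
    caddGate (d := d) i j ∈ Matrix.unitaryGroup (Fin n → ZMod d) ℂ := by
  rw [Matrix.mem_unitaryGroup_iff']
  have hinj : Function.Injective
      (fun y : Fin n → ZMod d => Function.update y j (y i + y j)) := by
    intro x y h
    have hk : ∀ k, k ≠ j → x k = y k := fun k hk => by
      simpa [Function.update_of_ne hk] using congrFun h k
    funext k
    by_cases hkj : k = j
    · subst hkj
      have := congrFun h k
      simp only [Function.update_self, hk i hij] at this
      exact add_left_cancel this
    · exact hk k hkj
  ext x y
  simp only [Matrix.mul_apply, Matrix.star_apply, caddGate, Matrix.of_apply, Matrix.one_apply]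
  simp only [apply_ite star, star_one, star_zero, ite_mul, one_mul, zero_mul,
    Finset.sum_ite_eq', Finset.mem_univ, if_true]
  exact if_congr hinj.eq_iff rfl rfl

/-- The `n`-qudit Clifford group: the subgroup of the unitary group of `(ℂ^d)^{⊗ n}` generated by
`H` and `P` on any qudit and `CADD` on any (ordered) pair of distinct qudits. -/
noncomputable def cliffordGroup (n d : ℕ) [NeZero d] :
    Subgroup (Matrix.unitaryGroup (Fin n → ZMod d) ℂ) :=
  Subgroup.closure
    ((Set.range fun i : Fin n =>
        ⟨onQudit i (fourierGate d), onQudit_mem_unitary i _ (fourierGate_mem_unitary d)⟩) ∪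
      (Set.range fun i : Fin n =>
        ⟨onQudit i (phaseGate d), onQudit_mem_unitary i _ (phaseGate_mem_unitary d)⟩) ∪
      (Set.range fun p : {p : Fin n × Fin n // p.1 ≠ p.2} =>
        ⟨caddGate p.1.1 p.1.2, caddGate_mem_unitary p.2⟩))

/-! ### Tensor power representations -/

/-- The matrix `U^{⊗ r} ⊗ Ū^{⊗ s}`, with `Ū` the entrywise complex conjugate of `U`. -/
def mixedTensorPower {κ : Type*} (r s : ℕ) (U : Matrix κ κ ℂ) :
    Matrix (Fin (r + s) → κ) (Fin (r + s) → κ) ℂ :=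
  tensorMatrix fun i => if i.val < r then U else U.map (starRingEnd ℂ)

theorem mixedTensorPower_one {κ : Type*} [DecidableEq κ] (r s : ℕ) :
    mixedTensorPower r s (1 : Matrix κ κ ℂ) = 1 := by
  simp only [mixedTensorPower, Matrix.map_one (starRingEnd ℂ) (map_zero _) (map_one _), ite_self,
    tensorMatrix_one]

theorem mixedTensorPower_mul {κ : Type*} [Fintype κ] (r s : ℕ) (U V : Matrix κ κ ℂ) :
    mixedTensorPower r s (U * V) = mixedTensorPower r s U * mixedTensorPower r s V := by
  rw [mixedTensorPower, mixedTensorPower, mixedTensorPower, tensorMatrix_mul]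
  congr 1
  funext i
  split_ifs
  · rfl
  · exact Matrix.map_mul

/-- `U ↦ U^{⊗ r} ⊗ Ū^{⊗ s}` is multiplicative. -/
def mixedTensorPowerHom (κ : Type*) [Fintype κ] [DecidableEq κ] (r s : ℕ) :
    Matrix κ κ ℂ →* Matrix (Fin (r + s) → κ) (Fin (r + s) → κ) ℂ where
  toFun := mixedTensorPower r s
  map_one' := mixedTensorPower_one r s
  map_mul' := mixedTensorPower_mul r s

/-- The representation `Δ_{r,s}(U) = U^{⊗ r} ⊗ Ū^{⊗ s}` of the Clifford group.  The standard basis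
of its space `ℋ_{n,t}`, `t = r + s`, is labelled by the `t × n` matrices `F` over `ℤ/d`. -/
noncomputable def Delta (n d r s : ℕ) [NeZero d] :
    Representation ℂ (cliffordGroup n d) ((Fin (r + s) → Fin n → ZMod d) → ℂ) :=
  ((Matrix.toLinAlgEquiv' (R := ℂ) (n := Fin (r + s) → Fin n → ZMod d)) : _ →* _).comp
    ((mixedTensorPowerHom (Fin n → ZMod d) r s).comp
      ((Matrix.unitaryGroup (Fin n → ZMod d) ℂ).subtype.comp (cliffordGroup n d).subtype))

theorem Delta_apply (n d r s : ℕ) [NeZero d] (U : cliffordGroup n d)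
    (ψ : (Fin (r + s) → Fin n → ZMod d) → ℂ) :
    Delta n d r s U ψ = (mixedTensorPower r s U.1.1).mulVec ψ :=
  rfl

/-- The standard basis vector `|F⟩`. -/
def ket {t n d : ℕ} (F : Fin t → Fin n → ZMod d) : (Fin t → Fin n → ZMod d) → ℂ :=
  Pi.single F 1

/-! ### The model quadratic spaces -/

/-- The model generalized quadratic form `q_{r,s} : T = (ℤ/d)^{r+s} → ℤ/D`,
`q_{r,s}(u) = u_1² + ⋯ + u_r² - u_{r+1}² - ⋯ - u_{r+s}²`.  The square mod `D` of `u_i ∈ ℤ/d` is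
computed on its representative in `{0, …, d-1}`; it does not depend on the representative. -/
def modelForm (d r s : ℕ) (u : Fin (r + s) → ZMod d) : ZMod (bigD d) :=
  ∑ i, (if i.val < r then 1 else -1) * ((u i).val : ZMod (bigD d)) ^ 2

/-- `g` is an isometry from `(T, q_{r,s})` to `(T, q_{r',s'})`. -/
def IsModelIsometry {d r s r' s' : ℕ}
    (g : (Fin (r + s) → ZMod d) ≃ₗ[ZMod d] (Fin (r' + s') → ZMod d)) : Prop :=
  ∀ u, modelForm d r' s' (g u) = modelForm d r s u

/-- The matrix `gF`: the linear map `g` is applied to each of the `n` columns of `F`. -/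
def actColumns {d t t' n : ℕ} (g : (Fin t → ZMod d) ≃ₗ[ZMod d] (Fin t' → ZMod d))
    (F : Fin t → Fin n → ZMod d) : Fin t' → Fin n → ZMod d :=
  fun i k => g (fun j => F j k) i

end CliffordTensor

/-!
The Clifford generators act on basis labels `F` through functions of the rows of `F` that are
visible to a linear map `g` acting on columns: `CADD` adds columns, which commutes with every linear
map; the Fourier transform multiplies by a character of the signed bilinear form
`∑ ± u_i v_i` modulo `d`; and the phase gate by a character of the signed sum of `u_i²` modulo `D`
(`d = 2`), or of `u_i (u_i - 1) / 2` modulo `d` (`d` odd).  Since the representations are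
multiplicative, the basis permutation of `g` intertwines them as soon as `g` preserves the
bilinear form, the model form and, for odd `d`, the signed sum of coordinates
(`IsCliffordIsometry`, `IsCliffordIsometry.exists_equiv`).

Such a `g` is built by exchanging a block of `m = s' - s` positive coordinates for negative ones,
leaving the others alone.  This needs a map of the block that reverses the sign of all three
functions (`IsCliffordAntiIsometry`).  For `d = 2` the congruence modulo `8` says `4 ∣ m`, and on
four qubits the map that complements the vectors of odd weight negates the weight modulo `4`.  For
odd `d` the hypotheses give `d ∣ m`, and a matrix `M` with `Mᵀ M = -1` exists in size one if
`-1` is a square, and in size two in general, as `-1` is a sum of two squares; `m` is even when the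
latter is needed.  Copies of `M` negate the bilinear form.  It remains to make the all-ones vector
a fixed point; it is isotropic because `d ∣ m`, and it can be reached from its image by at most
two reflections (`exists_antiIsometry_apply_eq`), an explicit case of Witt's theorem.
-/

namespace CliffordTensor

/-! ### Isometries compatible with the Clifford gates -/

/-- The sign of the `i`-th tensor factor of `U^{⊗ r} ⊗ Ū^{⊗ s}`: `1` on the factors `U` and `-1`
on the factors `Ū`. -/
def factorSign (r s : ℕ) (i : Fin (r + s)) : ℤ := if i.val < r then 1 else -1

/-- A linear isomorphism that preserves the three functions of the labels through which the
one-qudit Clifford gates act: the signed bilinear form modulo `d` (the Fourier transform), the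
model form modulo `D`, and, for odd `d`, the signed sum of the coordinates (together giving the
phase gate).  For odd `d` the last condition says that the all-ones vector is fixed. -/
structure IsCliffordIsometry {d r s r' s' : ℕ}
    (g : (Fin (r + s) → ZMod d) ≃ₗ[ZMod d] (Fin (r' + s') → ZMod d)) : Prop where
  bilin : ∀ u v, ∑ i, (factorSign r' s' i : ZMod d) * (g u i * g v i) =
    ∑ i, (factorSign r s i : ZMod d) * (u i * v i)
  quad : IsModelIsometry g
  lin : Odd d → ∀ u, ∑ i, (factorSign r' s' i : ZMod d) * g u i =
    ∑ i, (factorSign r s i : ZMod d) * u i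

theorem modelForm_eq_sum_factorSign (d r s : ℕ) (u : Fin (r + s) → ZMod d) :
    modelForm d r s u =
      ∑ i, (factorSign r s i : ZMod (bigD d)) * ((u i).val : ZMod (bigD d)) ^ 2 := by
  refine Finset.sum_congr rfl fun i _ => ?_
  rw [factorSign]
  split_ifs <;> simp

theorem IsCliffordIsometry.symm {d r s r' s' : ℕ}
    {g : (Fin (r + s) → ZMod d) ≃ₗ[ZMod d] (Fin (r' + s') → ZMod d)}
    (hg : IsCliffordIsometry g) : IsCliffordIsometry g.symm where
  bilin u v := by simpa using (hg.bilin (g.symm u) (g.symm v)).symm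
  quad u := by simpa using (hg.quad (g.symm u)).symm
  lin hd u := by simpa using (hg.lin hd (g.symm u)).symm

/-! ### Matrix entries of tensor powers of one-qudit gates -/

theorem mixedTensorPower_apply {κ : Type*} (r s : ℕ) (U : Matrix κ κ ℂ)
    (u v : Fin (r + s) → κ) :
    mixedTensorPower r s U u v =
      ∏ i, (if i.val < r then U (u i) (v i) else starRingEnd ℂ (U (u i) (v i))) := by
  simp only [mixedTensorPower, tensorMatrix, Matrix.of_apply]
  refine Finset.prod_congr rfl fun i _ => ?_
  split_ifs <;> rfl

/-- The entries of the tensor power of `⨂ l, A l` factor over the columns of the labels. -/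
theorem mixedTensorPower_tensorMatrix {ι κ : Type*} [Fintype ι] (r s : ℕ)
    (A : ι → Matrix κ κ ℂ) (F G : Fin (r + s) → ι → κ) :
    mixedTensorPower r s (tensorMatrix A) F G =
      ∏ l, mixedTensorPower r s (A l) (fun i => F i l) (fun i => G i l) := by
  simp only [mixedTensorPower_apply]
  rw [Finset.prod_comm]
  refine Finset.prod_congr rfl fun i _ => ?_
  simp only [tensorMatrix, Matrix.of_apply]
  split_ifs
  · rfl
  · rw [map_prod]

theorem stdAddChar_sum {ι : Type*} {N : ℕ} [NeZero N] (t : Finset ι) (f : ι → ZMod N) :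
    (ZMod.stdAddChar (∑ i ∈ t, f i) : ℂ) = ∏ i ∈ t, (ZMod.stdAddChar (f i) : ℂ) :=
  map_prod (ZMod.stdAddChar (N := N)).toMonoidHom (fun i => Multiplicative.ofAdd (f i)) t

theorem factor_stdAddChar {N : ℕ} [NeZero N] (r s : ℕ) (i : Fin (r + s)) (a : ZMod N) :
    (if i.val < r then (ZMod.stdAddChar a : ℂ) else starRingEnd ℂ (ZMod.stdAddChar a)) =
      ZMod.stdAddChar ((factorSign r s i : ZMod N) * a) := by
  rw [factorSign]
  split_ifs
  · simp
  · rw [← AddChar.map_neg_eq_conj]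
    simp

theorem mixedTensorPower_of_stdAddChar {κ : Type*} {N : ℕ} [NeZero N] (r s : ℕ) (c : ℝ)
    (b : κ → κ → ZMod N) (u v : Fin (r + s) → κ) :
    mixedTensorPower r s (Matrix.of fun x y => (c : ℂ) * ZMod.stdAddChar (b x y)) u v =
      (c : ℂ) ^ (r + s) *
        ZMod.stdAddChar (∑ i, (factorSign r s i : ZMod N) * b (u i) (v i)) := by
  rw [mixedTensorPower_apply, stdAddChar_sum]
  simp only [← factor_stdAddChar]
  rw [← Fin.prod_const, ← Finset.prod_mul_distrib]
  refine Finset.prod_congr rfl fun i _ => ?_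
  split_ifs <;> simp

theorem mixedTensorPower_diagonal_stdAddChar {κ : Type*} [DecidableEq κ] {N : ℕ} [NeZero N]
    (r s : ℕ) (p : κ → ZMod N) (u v : Fin (r + s) → κ) :
    mixedTensorPower r s (Matrix.diagonal fun x => (ZMod.stdAddChar (p x) : ℂ)) u v =
      if u = v then ZMod.stdAddChar (∑ i, (factorSign r s i : ZMod N) * p (u i)) else 0 := by
  rw [mixedTensorPower_apply]
  split_ifs with h
  · subst h
    rw [stdAddChar_sum]
    simp only [← factor_stdAddChar, Matrix.diagonal_apply_eq]
  · obtain ⟨i, hi⟩ := Function.ne_iff.1 h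
    refine Finset.prod_eq_zero (Finset.mem_univ i) ?_
    simp [Matrix.diagonal_apply_ne _ hi]

theorem fourierGate_eq_of_stdAddChar (d : ℕ) [NeZero d] :
    fourierGate d =
      Matrix.of fun x y => (((Real.sqrt d)⁻¹ : ℝ) : ℂ) * ZMod.stdAddChar (x * y) := by
  ext x y
  simp [fourierGate, omega_pow_val_mul]

theorem phaseGate_eq_of_even {d : ℕ} [NeZero d] [NeZero (bigD d)] (hd : Even d) :
    phaseGate d = Matrix.diagonal fun x =>
      (ZMod.stdAddChar ((x.val : ZMod (bigD d)) ^ 2) : ℂ) := by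
  rw [phaseGate]
  congr 1
  funext x
  have hx : ((x.val : ZMod (bigD d)) ^ 2) = (((x.val ^ 2 : ℕ) : ℤ) : ZMod (bigD d)) := by
    push_cast
    rfl
  rw [if_pos hd, hx, ZMod.stdAddChar_coe, tau, hd.neg_one_pow, one_mul, ← Complex.exp_nat_mul]
  congr 1
  rw [bigD, if_pos hd]
  have : (d : ℂ) ≠ 0 := Nat.cast_ne_zero.2 (NeZero.ne d)
  push_cast
  field_simp

/-- For odd `d` the exponent `x (x - 1)` of `τ` is even, and `τ² = ω`. -/
theorem phaseGate_eq_of_odd {d : ℕ} [NeZero d] (hd : ¬ Even d) :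
    phaseGate d = Matrix.diagonal fun x =>
      (ZMod.stdAddChar (((x.val : ℤ) * ((x.val : ℤ) - 1) / 2 : ℤ) : ZMod d) : ℂ) := by
  rw [phaseGate]
  congr 1
  funext x
  rw [if_neg hd, ZMod.stdAddChar_coe]
  obtain ⟨m, hm⟩ := (Int.even_mul_pred_self (x.val : ℤ)).two_dvd
  have htau : tau d ^ (2 : ℤ) = Complex.exp (2 * Real.pi * Complex.I / d) := by
    rw [tau, mul_zpow, ← Complex.exp_int_mul]
    have h1 : (((-1 : ℂ) ^ d) ^ (2 : ℤ)) = 1 := by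
      rw [zpow_ofNat, ← pow_mul, mul_comm, pow_mul]
      simp
    rw [h1, one_mul]
    congr 1
    push_cast
    ring
  rw [hm, Int.mul_ediv_cancel_left _ two_ne_zero, zpow_mul, htau, ← Complex.exp_int_mul]
  congr 1
  ring

variable {d r s r' s' : ℕ} {g : (Fin (r + s) → ZMod d) ≃ₗ[ZMod d] (Fin (r' + s') → ZMod d)}

theorem IsCliffordIsometry.mixedTensorPower_fourierGate [NeZero d] (hg : IsCliffordIsometry g)
    (ht : r + s = r' + s') (u v : Fin (r + s) → ZMod d) :
    mixedTensorPower r' s' (fourierGate d) (g u) (g v) =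
      mixedTensorPower r s (fourierGate d) u v := by
  rw [fourierGate_eq_of_stdAddChar, mixedTensorPower_of_stdAddChar,
    mixedTensorPower_of_stdAddChar, hg.bilin]
  congr 2
  exact ht.symm

theorem IsCliffordIsometry.mixedTensorPower_phaseGate [Fact d.Prime]
    (hg : IsCliffordIsometry g) (u v : Fin (r + s) → ZMod d) :
    mixedTensorPower r' s' (phaseGate d) (g u) (g v) =
      mixedTensorPower r s (phaseGate d) u v := by
  by_cases hd : Even d
  · have : NeZero (bigD d) := ⟨by simp [bigD, hd, NeZero.ne d]⟩
    have hq := hg.quad u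
    rw [modelForm_eq_sum_factorSign, modelForm_eq_sum_factorSign] at hq
    rw [phaseGate_eq_of_even hd, mixedTensorPower_diagonal_stdAddChar,
      mixedTensorPower_diagonal_stdAddChar, hq]
    exact if_congr g.injective.eq_iff rfl rfl
  · rw [phaseGate_eq_of_odd hd, mixedTensorPower_diagonal_stdAddChar,
      mixedTensorPower_diagonal_stdAddChar]
    refine if_congr g.injective.eq_iff (congrArg _ ?_) rfl
    have h2 : (2 : ZMod d) ≠ 0 := by
      have : Fact (2 < d) := ⟨lt_of_le_of_ne (Fact.out : d.Prime).two_le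
        (fun h => hd (h ▸ even_two))⟩
      exact ZMod.neg_one_ne_one.symm ∘ fun h => by linear_combination h
    -- Twice the exponent is `x² - x`, whose signed sum is preserved.
    have hexp : ∀ x : ZMod d,
        2 * (((x.val : ℤ) * ((x.val : ℤ) - 1) / 2 : ℤ) : ZMod d) = x * x - x := by
      intro x
      obtain ⟨m, hm⟩ := (Int.even_mul_pred_self (x.val : ℤ)).two_dvd
      have h := congrArg (Int.cast : ℤ → ZMod d) hm
      rw [hm, Int.mul_ediv_cancel_left _ two_ne_zero]
      push_cast [ZMod.natCast_val, ZMod.cast_id] at h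
      linear_combination -h
    apply mul_left_cancel₀ h2
    simp only [Finset.mul_sum, mul_left_comm (2 : ZMod d), hexp]
    simp only [mul_sub, Finset.sum_sub_distrib]
    rw [hg.bilin, hg.lin (Nat.not_even_iff_odd.1 hd)]

/-! ### The basis permutation intertwines the representations -/

variable {n : ℕ}

theorem mixedTensorPower_onQudit_actColumns (A : Matrix (ZMod d) (ZMod d) ℂ)
    (hA : ∀ u v, mixedTensorPower r' s' A (g u) (g v) = mixedTensorPower r s A u v)
    (i : Fin n) (F G : Fin (r + s) → Fin n → ZMod d) :
    mixedTensorPower r' s' (onQudit i A) (actColumns g F) (actColumns g G) =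
      mixedTensorPower r s (onQudit i A) F G := by
  rw [onQudit, mixedTensorPower_tensorMatrix, mixedTensorPower_tensorMatrix]
  refine Finset.prod_congr rfl fun l _ => ?_
  by_cases h : l = i
  · simp only [h, if_true]
    exact hA _ _
  · simp only [h, if_false, mixedTensorPower_one, Matrix.one_apply]
    exact if_congr g.injective.eq_iff rfl rfl

/-- The linear isomorphism `g`, applied to all columns, as a permutation of basis labels. -/
def actColumnsEquiv (n : ℕ) (g : (Fin (r + s) → ZMod d) ≃ₗ[ZMod d] (Fin (r' + s') → ZMod d)) :
    (Fin (r + s) → Fin n → ZMod d) ≃ (Fin (r' + s') → Fin n → ZMod d) where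
  toFun := actColumns g
  invFun := actColumns g.symm
  left_inv F := by
    funext i k
    simp [actColumns]
  right_inv F := by
    funext i k
    simp [actColumns]

theorem mixedTensorPower_caddGate_apply (r s : ℕ) (i j : Fin n)
    (F G : Fin (r + s) → Fin n → ZMod d) :
    mixedTensorPower r s (caddGate i j) F G =
      if F = fun a => Function.update (G a) j (G a i + G a j) then 1 else 0 := by
  rw [mixedTensorPower_apply]
  have h : ∀ a : Fin (r + s), (if a.val < r then caddGate i j (F a) (G a)
      else starRingEnd ℂ (caddGate i j (F a) (G a))) =
      if F a = Function.update (G a) j (G a i + G a j) then (1 : ℂ) else 0 := by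
    intro a
    simp only [caddGate, Matrix.of_apply]
    split_ifs <;> simp
  simp only [h, Finset.prod_ite_zero, Finset.mem_univ, true_imp_iff, Finset.prod_const_one,
    funext_iff]

/-- `CADD` adds one column of the label to another, which commutes with every linear map acting
on columns. -/
theorem mixedTensorPower_caddGate_actColumns (i j : Fin n) (F G : Fin (r + s) → Fin n → ZMod d) :
    mixedTensorPower r' s' (caddGate i j) (actColumns g F) (actColumns g G) =
      mixedTensorPower r s (caddGate i j) F G := by
  have h : (fun a => Function.update (actColumns g G a) j
        (actColumns g G a i + actColumns g G a j)) =
      actColumns g fun a => Function.update (G a) j (G a i + G a j) := by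
    funext a k
    by_cases hk : k = j
    · subst hk
      simp only [actColumns, Function.update_self]
      rw [← Pi.add_apply, ← map_add]
      rfl
    · simp only [actColumns, Function.update_of_ne hk]
  rw [mixedTensorPower_caddGate_apply, mixedTensorPower_caddGate_apply, h]
  exact if_congr (actColumnsEquiv n g).injective.eq_iff rfl rfl

/-- It suffices to compare the two tensor powers on the generators, because both are monoid
homomorphisms on the Clifford group. -/
theorem IsCliffordIsometry.mixedTensorPower_eq [Fact d.Prime] (hg : IsCliffordIsometry g)
    (ht : r + s = r' + s') (U : cliffordGroup n d) (F G : Fin (r + s) → Fin n → ZMod d) :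
    mixedTensorPower r' s' U.1.1 (actColumns g F) (actColumns g G) =
      mixedTensorPower r s U.1.1 F G := by
  let f₁ : Matrix.unitaryGroup (Fin n → ZMod d) ℂ →* _ :=
    (mixedTensorPowerHom (Fin n → ZMod d) r s).comp
      (Matrix.unitaryGroup (Fin n → ZMod d) ℂ).subtype
  let f₂ : Matrix.unitaryGroup (Fin n → ZMod d) ℂ →* _ :=
    ((Matrix.reindexAlgEquiv ℂ ℂ (actColumnsEquiv n g).symm).toAlgHom.toRingHom.toMonoidHom.comp
      (mixedTensorPowerHom (Fin n → ZMod d) r' s')).comp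
      (Matrix.unitaryGroup (Fin n → ZMod d) ℂ).subtype
  have h : Set.EqOn f₂ f₁ (cliffordGroup n d) := by
    refine MonoidHom.eqOn_closure ?_
    rintro _ ((⟨i, rfl⟩ | ⟨i, rfl⟩) | ⟨p, rfl⟩)
    · ext F G
      exact mixedTensorPower_onQudit_actColumns _ (hg.mixedTensorPower_fourierGate ht) i F G
    · ext F G
      exact mixedTensorPower_onQudit_actColumns _ hg.mixedTensorPower_phaseGate i F G
    · ext F G
      exact mixedTensorPower_caddGate_actColumns p.1.1 p.1.2 F G
  exact congrFun (congrFun (h U.2) F) G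

theorem IsCliffordIsometry.exists_equiv [Fact d.Prime] (hg : IsCliffordIsometry g)
    (ht : r + s = r' + s') :
    ∃ Φ : (Delta n d r s).Equiv (Delta n d r' s'),
      ∀ F : Fin (r + s) → Fin n → ZMod d, Φ (ket F) = ket (actColumns g F) := by
  let e := actColumnsEquiv n g
  refine ⟨Representation.Equiv.mk (LinearEquiv.funCongrLeft ℂ ℂ e.symm) fun U => ?_, fun F => ?_⟩
  · refine LinearMap.ext fun ψ => ?_
    funext F'
    obtain ⟨F, rfl⟩ := e.surjective F'
    change (Delta n d r s U ψ) (e.symm (e F)) = Delta n d r' s' U (fun G => ψ (e.symm G)) (e F)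
    rw [e.symm_apply_apply, Delta_apply, Delta_apply]
    simp only [Matrix.mulVec, dotProduct]
    rw [← e.sum_comp]
    refine Finset.sum_congr rfl fun G _ => ?_
    rw [e.symm_apply_apply]
    congr 1
    exact (hg.mixedTensorPower_eq ht U F G).symm
  · funext F'
    change (ket F : _ → ℂ) (e.symm F') = ket (e F) F'
    simp only [ket, Pi.single_apply, Equiv.symm_apply_eq]

/-! ### Sign-reversing maps on a block of coordinates -/

open scoped Matrix

/-- A linear map on a block of coordinates that reverses the sign of the three functions preserved
by an `IsCliffordIsometry`. -/
structure IsCliffordAntiIsometry {d : ℕ} {κ : Type*} [Fintype κ]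
    (B : (κ → ZMod d) →ₗ[ZMod d] (κ → ZMod d)) : Prop where
  bilin : ∀ u v, B u ⬝ᵥ B v = -(u ⬝ᵥ v)
  quad : ∀ u, ∑ i, ((B u i).val : ZMod (bigD d)) ^ 2 = -∑ i, ((u i).val : ZMod (bigD d)) ^ 2
  lin : Odd d → ∀ u, ∑ i, B u i = -∑ i, u i

section Field

variable {K κ : Type*} [Field K] [Fintype κ]

/-- The reflection in `v - w` is an isometry that exchanges two vectors `v`, `w` of the same
length. -/
theorem exists_isometry_apply_eq {v w : κ → K} (hvw : v ⬝ᵥ v = w ⬝ᵥ w)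
    (h : (v - w) ⬝ᵥ (v - w) ≠ 0) :
    ∃ R : (κ → K) →ₗ[K] (κ → K), (∀ x y, R x ⬝ᵥ R y = x ⬝ᵥ y) ∧ R v = w := by
  set a := v - w with ha
  set c := 2 / (a ⬝ᵥ a) with hc
  have hca : c * (a ⬝ᵥ a) = 2 := div_mul_cancel₀ _ h
  let R : (κ → K) →ₗ[K] (κ → K) :=
    { toFun := fun x => x - (c * (a ⬝ᵥ x)) • a
      map_add' := fun x y => by
        rw [dotProduct_add]
        module
      map_smul' := fun t x => by
        rw [dotProduct_smul, smul_eq_mul, RingHom.id_apply]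
        module }
  refine ⟨R, fun x y => ?_, ?_⟩
  · change (x - (c * (a ⬝ᵥ x)) • a) ⬝ᵥ (y - (c * (a ⬝ᵥ y)) • a) = x ⬝ᵥ y
    simp only [sub_dotProduct, dotProduct_sub, smul_dotProduct, dotProduct_smul, smul_eq_mul]
    rw [dotProduct_comm x a]
    linear_combination c * (a ⬝ᵥ x) * (a ⬝ᵥ y) * hca
  · change v - (c * (a ⬝ᵥ v)) • a = w
    have hav : 2 * (a ⬝ᵥ v) = a ⬝ᵥ a := by
      simp only [ha, sub_dotProduct, dotProduct_sub]
      rw [dotProduct_comm v w]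
      linear_combination hvw
    have : c * (a ⬝ᵥ v) = 1 := by
      rw [hc, div_mul_eq_mul_div, hav, div_self h]
    rw [this, one_smul, ha, sub_sub_cancel]

/-- An anti-isometry can be corrected by isometries so that it fixes an isotropic vector `w`.  If
its value at `w` is orthogonal to `w`, a coordinate is flipped first, so that afterwards the
difference with `w` is not isotropic and the reflection in it exists. -/
theorem exists_antiIsometry_apply_eq (h2 : (2 : K) ≠ 0) {w : κ → K} (hw : w ⬝ᵥ w = 0)
    (hne : ∀ k, w k ≠ 0)
    (A : (κ → K) →ₗ[K] (κ → K)) (hA : ∀ x y, A x ⬝ᵥ A y = -(x ⬝ᵥ y)) :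
    ∃ B : (κ → K) →ₗ[K] (κ → K), (∀ x y, B x ⬝ᵥ B y = -(x ⬝ᵥ y)) ∧ B w = w := by
  classical
  have main : ∀ A : (κ → K) →ₗ[K] (κ → K), (∀ x y, A x ⬝ᵥ A y = -(x ⬝ᵥ y)) → A w ⬝ᵥ w ≠ 0 →
      ∃ B : (κ → K) →ₗ[K] (κ → K), (∀ x y, B x ⬝ᵥ B y = -(x ⬝ᵥ y)) ∧ B w = w := by
    intro A hA h0
    have hAw : A w ⬝ᵥ A w = 0 := by rw [hA, hw, neg_zero]
    obtain ⟨R, hR, hRw⟩ := exists_isometry_apply_eq (v := A w) (w := w) (by rw [hAw, hw]) (by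
      simp only [sub_dotProduct, dotProduct_sub, hAw, hw]
      rw [dotProduct_comm w (A w)]
      intro h
      exact mul_ne_zero h2 h0 (by linear_combination -h))
    exact ⟨R ∘ₗ A, fun x y => (hR _ _).trans (hA x y), hRw⟩
  by_cases h0 : A w ⬝ᵥ w = 0
  swap
  · exact main A hA h0
  by_cases hv : A w = 0
  · -- Anti-isometries are injective, so this happens only on the empty block.
    have hw0 : w = 0 := by
      funext k
      have h := hA w (Pi.single k 1)
      rw [hv, zero_dotProduct, dotProduct_single_one] at h
      exact neg_eq_zero.1 h.symm
    exact ⟨A, hA, hv.trans hw0.symm⟩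
  obtain ⟨k, hk⟩ := Function.ne_iff.1 hv
  rw [Pi.zero_apply] at hk
  obtain ⟨R, hR, hRv⟩ := exists_isometry_apply_eq (v := A w)
    (w := A w - Pi.single k (2 * A w k)) (by
      simp only [sub_dotProduct, dotProduct_sub, dotProduct_single, single_dotProduct,
        Pi.sub_apply, Pi.single_eq_same]
      ring) (by
      rw [sub_sub_cancel, single_dotProduct, Pi.single_eq_same]
      exact mul_self_ne_zero.2 (mul_ne_zero h2 hk))
  refine main (R ∘ₗ A) (fun x y => (hR _ _).trans (hA x y)) ?_
  rw [LinearMap.comp_apply, hRv, sub_dotProduct, h0, single_dotProduct, zero_sub]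
  exact neg_ne_zero.2 (mul_ne_zero (mul_ne_zero h2 hk) (hne k))

end Field

/-- The linear map acting by the matrix `M` on each of the blocks `{a} × ι` of `κ × ι`. -/
def blockMap {K ι : Type*} (κ : Type*) [CommRing K] [Fintype ι] (M : Matrix ι ι K) :
    (κ × ι → K) →ₗ[K] (κ × ι → K) where
  toFun u x := (M *ᵥ fun l => u (x.1, l)) x.2
  map_add' u v := by
    funext x
    exact congrFun (Matrix.mulVec_add M (fun l => u (x.1, l)) (fun l => v (x.1, l))) x.2
  map_smul' c u := by
    funext x
    exact congrFun (Matrix.mulVec_smul M c (fun l => u (x.1, l))) x.2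

theorem blockMap_dotProduct_blockMap {K ι κ : Type*} [CommRing K] [Fintype ι] [DecidableEq ι]
    [Fintype κ] {M : Matrix ι ι K} (hM : Mᵀ * M = -1) (u v : κ × ι → K) :
    blockMap κ M u ⬝ᵥ blockMap κ M v = -(u ⬝ᵥ v) := by
  simp only [dotProduct, Fintype.sum_prod_type]
  rw [← Finset.sum_neg_distrib]
  refine Finset.sum_congr rfl fun a _ => ?_
  change (M *ᵥ fun l => u (a, l)) ⬝ᵥ (M *ᵥ fun l => v (a, l)) =
    -((fun l => u (a, l)) ⬝ᵥ fun l => v (a, l))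
  rw [Matrix.dotProduct_mulVec, Matrix.vecMul_mulVec, hM, Matrix.vecMul_neg, Matrix.vecMul_one,
    neg_dotProduct]

/-- For odd `d` a matrix `M` with `Mᵀ M = -1` gives a sign-reversing map on any block that consists
of copies of its index set and has size divisible by `d`: the all-ones vector is then isotropic,
and can be made a fixed point. -/
theorem exists_isCliffordAntiIsometry_of_odd {d p k : ℕ} [Fact d.Prime] (hd : Odd d)
    {M : Matrix (Fin p) (Fin p) (ZMod d)} (hM : Mᵀ * M = -1) (hdvd : d ∣ k * p) :
    ∃ B : (Fin k × Fin p → ZMod d) →ₗ[ZMod d] (Fin k × Fin p → ZMod d),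
      IsCliffordAntiIsometry B := by
  have h2 : (2 : ZMod d) ≠ 0 := by
    have : Fact (2 < d) := ⟨lt_of_le_of_ne (Fact.out : d.Prime).two_le
      (fun h => by subst h; exact absurd hd (by decide))⟩
    exact fun h => ZMod.neg_one_ne_one (n := d) (by linear_combination -h)
  have hone : (1 : Fin k × Fin p → ZMod d) ⬝ᵥ 1 = 0 := by
    rw [one_dotProduct_one, Fintype.card_prod, Fintype.card_fin, Fintype.card_fin]
    exact (ZMod.natCast_eq_zero_iff _ _).2 hdvd
  obtain ⟨B, hB, hB1⟩ := exists_antiIsometry_apply_eq h2 hone (fun _ => one_ne_zero)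
    (blockMap (Fin k) M) (blockMap_dotProduct_blockMap hM)
  refine ⟨B, hB, fun u => ?_, fun _ u => ?_⟩
  · have hN : bigD d = d := if_neg (Nat.not_even_iff_odd.2 hd)
    rw [hN]
    simpa [dotProduct, sq] using hB u u
  · have h := hB u 1
    rwa [hB1, dotProduct_one, dotProduct_one] at h

/-- On four qubits, complementing the vectors of odd weight is linear over `ℤ/2` and negates the
weight modulo `4`. -/
theorem exists_isCliffordAntiIsometry_two (k : ℕ) :
    ∃ B : (Fin k × Fin 4 → ZMod 2) →ₗ[ZMod 2] (Fin k × Fin 4 → ZMod 2),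
      IsCliffordAntiIsometry B := by
  let M : Matrix (Fin 4) (Fin 4) (ZMod 2) :=
    !![0, 1, 1, 1; 1, 0, 1, 1; 1, 1, 0, 1; 1, 1, 1, 0]
  refine ⟨blockMap (Fin k) M, blockMap_dotProduct_blockMap (by decide), fun u => ?_,
    fun h => absurd h (by decide)⟩
  have hN : bigD 2 = 4 := rfl
  rw [hN]
  have key : ∀ v : Fin 4 → ZMod 2,
      ∑ i, (((M *ᵥ v) i).val : ZMod 4) ^ 2 = -∑ i, ((v i).val : ZMod 4) ^ 2 := by
    decide
  simp only [Fintype.sum_prod_type]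
  rw [← Finset.sum_neg_distrib]
  exact Finset.sum_congr rfl fun a _ => key fun l => u (a, l)

/-! ### Trading positive for negative coordinates -/

section Trade

variable {d r s r' s' : ℕ}

theorem factorSign_castAdd (r s : ℕ) (i : Fin r) : factorSign r s (Fin.castAdd s i) = 1 := by
  simp [factorSign]

theorem factorSign_natAdd (r s : ℕ) (i : Fin s) : factorSign r s (Fin.natAdd r i) = -1 := by
  simp [factorSign]

/-- A sign-reversing map on a block of positive coordinates, extended by the identity, is an
isometry onto the model space in which the block is negative. -/
theorem IsCliffordAntiIsometry.exists_isCliffordIsometry [Fact d.Prime] {κ : Type*} [Fintype κ]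
    {B : (κ → ZMod d) →ₗ[ZMod d] (κ → ZMod d)} (hB : IsCliffordAntiIsometry B)
    (a b : ℕ) {m : ℕ} (hm : Fintype.card κ = m) :
    ∃ g : (Fin (a + m + b) → ZMod d) ≃ₗ[ZMod d] (Fin (a + (b + m)) → ZMod d),
      IsCliffordIsometry g := by
  let c : κ ≃ Fin m := Fintype.equivFinOfCardEq hm
  let L : (Fin (a + m + b) → ZMod d) →ₗ[ZMod d] (Fin (a + (b + m)) → ZMod d) :=
    LinearMap.pi (Fin.addCases
      (fun i => LinearMap.proj (Fin.castAdd b (Fin.castAdd m i)))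
      (Fin.addCases
        (fun j => LinearMap.proj (Fin.natAdd (a + m) j))
        (fun k => LinearMap.proj (c.symm k) ∘ₗ B ∘ₗ
          LinearMap.funLeft (ZMod d) (ZMod d) fun x => Fin.castAdd b (Fin.natAdd a (c x)))))
  -- The part of a label on the exchanged block.
  let blk : (Fin (a + m + b) → ZMod d) → κ → ZMod d :=
    fun u x => u (Fin.castAdd b (Fin.natAdd a (c x)))
  have hL1 : ∀ u i, L u (Fin.castAdd (b + m) i) = u (Fin.castAdd b (Fin.castAdd m i)) := by
    intro u i
    simp [L]
  have hL2 : ∀ u j, L u (Fin.natAdd a (Fin.castAdd m j)) = u (Fin.natAdd (a + m) j) := by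
    intro u j
    simp [L]
  have hL3 : ∀ u k, L u (Fin.natAdd a (Fin.natAdd b k)) = B (blk u) (c.symm k) := by
    intro u k
    simp only [L, LinearMap.pi_apply, Fin.addCases_right]
    rfl
  have hsrc : ∀ {R : Type} [CommRing R] (f : Fin (a + m + b) → R),
      ∑ i, (factorSign (a + m) b i : R) * f i =
        ∑ i, f (Fin.castAdd b (Fin.castAdd m i)) +
          ∑ x, f (Fin.castAdd b (Fin.natAdd a (c x))) - ∑ j, f (Fin.natAdd (a + m) j) := by
    intro R _ f
    rw [Fin.sum_univ_add]
    simp only [factorSign_castAdd, factorSign_natAdd, Int.cast_one, one_mul, Int.cast_neg,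
      neg_mul, Finset.sum_neg_distrib]
    rw [Fin.sum_univ_add, ← c.sum_comp]
    ring
  have htgt : ∀ {R : Type} [CommRing R] (f : Fin (a + (b + m)) → R),
      ∑ i, (factorSign a (b + m) i : R) * f i =
        ∑ i, f (Fin.castAdd (b + m) i) -
          ∑ x, f (Fin.natAdd a (Fin.natAdd b (c x))) -
            ∑ j, f (Fin.natAdd a (Fin.castAdd m j)) := by
    intro R _ f
    rw [Fin.sum_univ_add]
    simp only [factorSign_castAdd, factorSign_natAdd, Int.cast_one, one_mul, Int.cast_neg,
      neg_mul, Finset.sum_neg_distrib]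
    rw [Fin.sum_univ_add, ← c.sum_comp]
    ring
  have hbilin : ∀ u v, ∑ i, (factorSign a (b + m) i : ZMod d) * (L u i * L v i) =
      ∑ i, (factorSign (a + m) b i : ZMod d) * (u i * v i) := by
    intro u v
    rw [hsrc, htgt]
    simp only [hL1, hL2, hL3, Equiv.symm_apply_apply]
    have h := hB.bilin (blk u) (blk v)
    simp only [dotProduct, blk] at h
    linear_combination -h
  have hinj : Function.Injective L := by
    rw [← LinearMap.ker_eq_bot, LinearMap.ker_eq_bot']
    intro u hu
    funext i
    have h := hbilin u (Pi.single i 1)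
    rw [hu, Fintype.sum_eq_single i (fun j hj => by simp [Pi.single_eq_of_ne hj])] at h
    simp only [Pi.zero_apply, zero_mul, mul_zero, Finset.sum_const_zero, Pi.single_eq_same,
      mul_one] at h
    refine (mul_eq_zero.1 h.symm).resolve_left ?_
    rw [factorSign]
    split_ifs <;> simp
  refine ⟨LinearMap.linearEquivOfInjective L hinj (by simp; omega), hbilin, fun u => ?_,
    fun hd u => ?_⟩
  · rw [modelForm_eq_sum_factorSign, modelForm_eq_sum_factorSign, hsrc, htgt]
    simp only [LinearMap.linearEquivOfInjective_apply, hL1, hL2, hL3, Equiv.symm_apply_apply]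
    have h := hB.quad (blk u)
    simp only [blk] at h ⊢
    linear_combination -h
  · rw [hsrc, htgt]
    simp only [LinearMap.linearEquivOfInjective_apply, hL1, hL2, hL3, Equiv.symm_apply_apply]
    have h := hB.lin hd (blk u)
    simp only [blk] at h ⊢
    linear_combination -h

/-- The numerical conditions make `s' - s` a multiple of `4` for `d = 2`, a multiple of `d` for
odd `d`, and in addition even if `-1` is not a square modulo `d`. -/
theorem exists_isCliffordIsometry_of_le [Fact d.Prime] (hs : s ≤ s')
    (ht : r + s = r' + s')
    (hodd : Odd d → (r : ℤ) - (s : ℤ) ≡ (r' : ℤ) - (s' : ℤ) [ZMOD (d : ℤ)])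
    (hcase : d ≡ 1 [MOD 4] ∨
      (d ≡ 3 [MOD 4] ∧ s ≡ s' [MOD 2]) ∨
      (d = 2 ∧ (r : ℤ) - (s : ℤ) ≡ (r' : ℤ) - (s' : ℤ) [ZMOD 8])) :
    ∃ g : (Fin (r + s) → ZMod d) ≃ₗ[ZMod d] (Fin (r' + s') → ZMod d), IsCliffordIsometry g := by
  obtain ⟨m, rfl⟩ := Nat.exists_eq_add_of_le hs
  obtain rfl : r = r' + m := by omega
  suffices h : ∃ p k : ℕ, k * p = m ∧
      ∃ B : (Fin k × Fin p → ZMod d) →ₗ[ZMod d] (Fin k × Fin p → ZMod d),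
        IsCliffordAntiIsometry B by
    obtain ⟨p, k, hm, B, hB⟩ := h
    exact hB.exists_isCliffordIsometry r' s (by simpa using hm)
  have hdvd : Odd d → d ∣ m := by
    intro hd
    have h := (Int.modEq_iff_dvd.1 (hodd hd))
    have h2 : (d : ℤ) ∣ 2 * m := by
      have he : (r' : ℤ) - ((s + m : ℕ) : ℤ) - (((r' + m : ℕ) : ℤ) - s) = -(2 * m) := by
        push_cast
        ring
      rwa [he, dvd_neg] at h
    have hcop : Nat.Coprime d 2 := Nat.coprime_two_right.2 hd
    exact hcop.dvd_of_dvd_mul_left (by exact_mod_cast h2)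
  rcases hcase with h1 | ⟨h3, hpar⟩ | ⟨rfl, h8⟩
  · have hd : Odd d := Nat.odd_iff.2 (by unfold Nat.ModEq at h1; omega)
    obtain ⟨i, hi⟩ := ZMod.exists_sq_eq_neg_one_iff.2 (show d % 4 ≠ 3 by
      unfold Nat.ModEq at h1; omega)
    refine ⟨1, m, mul_one m, exists_isCliffordAntiIsometry_of_odd hd (M := !![i]) ?_
      (by simpa using hdvd hd)⟩
    ext x y
    fin_cases x
    fin_cases y
    simp [Matrix.mul_apply, ← hi]
  · have hd : Odd d := Nat.odd_iff.2 (by unfold Nat.ModEq at h3; omega)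
    obtain ⟨k, rfl⟩ : 2 ∣ m := by unfold Nat.ModEq at hpar; omega
    obtain ⟨x, y, hxy⟩ := ZMod.sq_add_sq d (-1)
    refine ⟨2, k, mul_comm k 2, exists_isCliffordAntiIsometry_of_odd hd (M := !![x, -y; y, x]) ?_
      (by rw [mul_comm]; exact hdvd hd)⟩
    ext i j
    fin_cases i <;> fin_cases j <;> simp [Matrix.mul_apply, Fin.sum_univ_two, ← hxy] <;> ring
  · obtain ⟨k, rfl⟩ : 4 ∣ m := by
      have h := Int.modEq_iff_dvd.1 h8
      push_cast at h
      omega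
    exact ⟨4, k, mul_comm k 4, exists_isCliffordAntiIsometry_two k⟩

end Trade

end CliffordTensor

theorem mainTheorem9 (d n r s r' s' : ℕ) [Fact d.Prime]
    (ht : r + s = r' + s')
    (hodd : Odd d → (r : ℤ) - (s : ℤ) ≡ (r' : ℤ) - (s' : ℤ) [ZMOD (d : ℤ)])
    (hcase : d ≡ 1 [MOD 4] ∨
      (d ≡ 3 [MOD 4] ∧ s ≡ s' [MOD 2]) ∨
      (d = 2 ∧ (r : ℤ) - (s : ℤ) ≡ (r' : ℤ) - (s' : ℤ) [ZMOD 8])) :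
    ∃ g : (Fin (r + s) → ZMod d) ≃ₗ[ZMod d] (Fin (r' + s') → ZMod d),
      CliffordTensor.IsModelIsometry g ∧
      ∃ Φ : (CliffordTensor.Delta n d r s).Equiv (CliffordTensor.Delta n d r' s'),
        ∀ F : Fin (r + s) → Fin n → ZMod d,
          Φ (CliffordTensor.ket F) = CliffordTensor.ket (CliffordTensor.actColumns g F) := by
  have key : ∃ g : (Fin (r + s) → ZMod d) ≃ₗ[ZMod d] (Fin (r' + s') → ZMod d),
      CliffordTensor.IsCliffordIsometry g := by
    rcases le_total s s' with hs | hs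
    · exact CliffordTensor.exists_isCliffordIsometry_of_le hs ht hodd hcase
    · obtain ⟨g, hg⟩ := CliffordTensor.exists_isCliffordIsometry_of_le hs ht.symm
        (fun hd => (hodd hd).symm)
        (hcase.imp_right (Or.imp (And.imp_right Nat.ModEq.symm) (And.imp_right Int.ModEq.symm)))
      exact ⟨g.symm, hg.symm⟩
  obtain ⟨g, hg⟩ := key
  exact ⟨g, hg.quad, hg.exists_equiv ht⟩
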